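/- **Setting.** Let $X_1,X_2,\dots$ be i.i.d. real random variables with Lebesgue density $g$ and cdf $G$. Let $\Pi$ be a prior probability on the set $\mathscr G$ of Lebesgue probability densities on $\mathbb R$, given as the law of a jointly measurable random density, with posterior $\Pi(B\mid X_1,\dots,X_n)=\int_B\prod_{i\le n}h(X_i)\,d\Pi(h)\big/\int_{\mathscr G}\prod_{i\le n}h(X_i)\,d\Pi(h)$. Let $g_n^*=\int h\,\Pi(dh\mid X_1,\dots,X_n)$ be the Bayesian density estimate, $\tilde G_n^*$ its cdf, and $B_n=n^{1/2}[\tilde G_n^*-G]$. Write $\|\cdot\|$ for the norm of $L_2(\mathbb R)$. Call $\sigma\in L_2(\mathbb R)$ a *direction* if $\sigma=0$ a.e. on $\{g=0\}$ and $\int\sigma g^{1/2}\,dx=0$. Let $\{f_t:t\in\Theta\}$, $\Theta\subset\mathbb R^p$, be a family of Lebesgue probability densities, and let $T$ be a minimum Hellinger distance functional: for every $h\in\mathscr G$ for which $t\mapsto\|f_t^{1/2}-h^{1/2}\|$ has a minimizer over $\Theta$, $T(h)$ is such a minimizer. **Condition A1.** (i) For every $t\in\Theta$ there are a vector $\dot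 f_t^{1/2}$ and a $p\times p$ matrix $\ddot f_t^{1/2}$ of functions in $L_2$ such that for each unit vector $l$ and all small scalars $a$ with $t+al\in\Theta$, $$f_{t+al}^{1/2}=f_t^{1/2}+a\,l^T\dot f_t^{1/2}+a\,l^Tu_a,\qquad \dot f_{t+al}^{1/2}=\dot f_t^{1/2}+a\,l^T\ddot f_t^{1/2}+a\,l^Tv_a,$$ where the components of $u_a$ and $v_a$ tend to $0$ in $L_2$ as $a\to0$. (ii) A minimizer of $t\mapsto\|f_t^{1/2}-g^{1/2}\|$ over $\Theta$ exists, is unique (so it is $T(g)$), and lies in the interior of $\Theta$. (iii) The matrix $\int\ddot f_{T(g)}^{1/2}(x)\,g^{1/2}(x)\,dx$ is nonsingular. (iv) $T$ is continuous at $g$ in the Hellinger topology, on the set of densities for which a minimizer exists. **Condition A2.** For every direction $\sigma$, $\;n^{1/2}\int\sigma(x)\,[g_n^{*1/2}(x)-g^{1/2}(x)]\,dx\;$ converges in distribution to $N(0,\|\sigma\|^2/4)$. **Lemma.** Let $k$ be a probability density on $\mathbb R$, $(c_n)$ a sequence of real constants, $s_n=s_n(X_1,\dots,X_n)$ a scale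 estimator, and $K\subset\mathbb R$ a compact set outside of which $g$ vanishes. Suppose that: - for every direction $\sigma$, $\displaystyle\int\frac{\sigma(x)}{2g^{1/2}(x)}\,dB_n(x)$ converges in distribution to $N(0,\|\sigma\|^2/4)$; - $g_n^*$ concentrates at $g$ on $K$ at rate $o(n^{-1/4})$: there are constants $\varepsilon_n=o(n^{-1/4})$ with $P\big(\|g_n^*-g\|_{L_4(K)}>\varepsilon_n\big)\to0$ (this holds in particular if $\sup_K|g_n^*-g|=o_P(n^{-1/4})$); - Condition A1 holds; - (b1) $k$ is symmetric about $0$ and has compact support; - (b2) $k$ is twice absolutely continuous (that is, $k'$ exists everywhere and is absolutely continuous on compact intervals) and $k''$ is bounded; - (b3) $g>0$ on $K$, and on $K$ the density $g$ coincides with a function on $\mathbb R$ that is twice absolutely continuous with bounded second derivative; - (b4) $n^{1/2}c_n\to\infty$ and $n^{1/2}c_n^2\to0$; - (b5) there is a finite constant $s>0$, depending on $g$, such that $n^{1/2}(s_n-s)$ is bounded in probability. Then Condition A2 holds. -/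

import Mathlib

open MeasureTheory ProbabilityTheory Filter Topology

noncomputable section

/-- `f` is a probability density on the real line with respect to Lebesgue measure. -/
structure IsDensity (f : ℝ → ℝ) : Prop where
  measurable : Measurable f
  nonneg : ∀ x, 0 ≤ f x
  integrable : Integrable f volume
  integral_eq_one : ∫ x, f x = 1

/-- The measure `f(x) dx` on the real line, i.e. the measure `dG` for the cdf `G` with density `f`. -/
def densityMeasure (f : ℝ → ℝ) : Measure ℝ :=
  volume.withDensity (fun x => ENNReal.ofReal (f x))

/-- The first `n` observations `(X_1, …, X_n)`; the sequence is indexed from `0`. -/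
def sample {Ω : Type*} (X : ℕ → Ω → ℝ) (n : ℕ) (ω : Ω) : Fin n → ℝ := fun i => X i ω

/-! ### Bayesian nonparametric density estimation

A prior on the space of densities is given as the law of a random density: a probability measure
`prior` on a measurable space `H` and a jointly measurable map `(h, x) ↦ d h x` such that each
`d h` is a density (for a Dirichlet mixture `h` is the mixing distribution). -/

/-- The likelihood `∏_{i ≤ n} g(x_i)` of the random density `g = d h`. -/
def likelihood {H : Type*} (d : H → ℝ → ℝ) {n : ℕ} (x : Fin n → ℝ) (h : H) : ENNReal :=
  ∏ i, ENNReal.ofReal (d h (x i))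

/-- The posterior `Π(B | x_1, …, x_n) = ∫_B ∏ g(x_i) dΠ(g) / ∫ ∏ g(x_i) dΠ(g)`. -/
def posterior {H : Type*} [MeasurableSpace H] (prior : Measure H) (d : H → ℝ → ℝ) {n : ℕ}
    (x : Fin n → ℝ) : Measure H :=
  (∫⁻ h, likelihood d x h ∂prior)⁻¹ • prior.withDensity (likelihood d x)

/-- The Bayesian density estimate `g_n^* = ∫ g Π(dg | x_1, …, x_n)`, evaluated at `y`. -/
def posteriorMean {H : Type*} [MeasurableSpace H] (prior : Measure H) (d : H → ℝ → ℝ) {n : ℕ}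
    (x : Fin n → ℝ) (y : ℝ) : ℝ :=
  ∫ h, d h y ∂(posterior prior d x)

/-- The Lebesgue-Stieltjes integral `∫ ψ dB_n` against `B_n = n^{1/2} (G_n^* - G)`, where `G_n^*`
and `G` are the cdfs with densities `gs` and `g`. -/
def integralB (n : ℕ) (gs g ψ : ℝ → ℝ) : ℝ :=
  √(n : ℝ) * (∫ x, ψ x ∂(densityMeasure gs) - ∫ x, ψ x ∂(densityMeasure g))

/-- The directions `σ`: `σ ∈ L_2`, `σ ⟂ g^{1/2}`, and `σ` lives on the support of `g`. -/
structure IsDirection (g σ : ℝ → ℝ) : Prop where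
  memLp : MemLp σ 2 volume
  orthogonal : ∫ x, σ x * √(g x) = 0
  support : ∀ᵐ x, g x = 0 → σ x = 0

/-- The real random variables `Z n` converge in distribution to `N(0, ‖σ‖² / 4)`, where
`‖σ‖` is the `L_2` norm. -/
def TendstoNormal {Ω : Type*} [MeasurableSpace Ω] (P : Measure Ω) [IsProbabilityMeasure P]
    (Z : ℕ → Ω → ℝ) (σ : ℝ → ℝ) : Prop :=
  TendstoInDistribution Z atTop (id : ℝ → ℝ) (fun _ => P)
    (gaussianReal 0 (Real.toNNReal ((∫ x, σ x ^ 2) / 4)))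

/-- The Gaussian limit of `B_n`: for every direction `σ`,
`∫ σ / (2 g^{1/2}) dB_n` converges in distribution to `N(0, ‖σ‖² / 4)`.
Here `gs n ω` is the density estimate based on the first `n` observations. -/
def GaussianLimitB {Ω : Type*} [MeasurableSpace Ω] (P : Measure Ω) [IsProbabilityMeasure P]
    (gs : ℕ → Ω → ℝ → ℝ) (g : ℝ → ℝ) : Prop :=
  ∀ σ : ℝ → ℝ, IsDirection g σ →
    TendstoNormal P (fun n ω => integralB n (gs n ω) g (fun x => σ x / (2 * √(g x)))) σ

/-- Condition A2: for every direction `σ`, `n^{1/2} ∫ σ (g_n^{*1/2} - g^{1/2}) dx` converges in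
distribution to `N(0, ‖σ‖² / 4)`. -/
def ConditionA2 {Ω : Type*} [MeasurableSpace Ω] (P : Measure Ω) [IsProbabilityMeasure P]
    (gs : ℕ → Ω → ℝ → ℝ) (g : ℝ → ℝ) : Prop :=
  ∀ σ : ℝ → ℝ, IsDirection g σ →
    TendstoNormal P (fun n ω => √(n : ℝ) * ∫ x, σ x * (√(gs n ω x) - √(g x))) σ

/-- The estimates `gs n` concentrate at `g` with rate `ε n`, in the `L_4` metric on `K`. -/
def HasConcentrationRate {Ω : Type*} [MeasurableSpace Ω] (P : Measure Ω)
    (gs : ℕ → Ω → ℝ → ℝ) (g : ℝ → ℝ) (K : Set ℝ) (ε : ℕ → ℝ) : Prop :=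
  Tendsto (fun n => P {ω | ENNReal.ofReal (ε n) <
    eLpNorm (fun x => gs n ω x - g x) 4 (volume.restrict K)}) atTop (𝓝 0)

/-- The sequence of random variables `Z n` is bounded in probability. -/
def BoundedInProbability {Ω : Type*} [MeasurableSpace Ω] (P : Measure Ω) (Z : ℕ → Ω → ℝ) : Prop :=
  ∀ η : ℝ, 0 < η → ∃ M : ℝ, ∀ᶠ n in atTop, P {ω | M < |Z n ω|} ≤ ENNReal.ofReal η

/-- `f` is twice absolutely continuous (that is, `f'` exists everywhere and is absolutely
continuous on every compact interval) and its almost everywhere defined second derivative is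
bounded. -/
structure TwiceACBounded (f : ℝ → ℝ) : Prop where
  differentiable : Differentiable ℝ f
  absolutelyContinuous_deriv : ∀ a b : ℝ, AbsolutelyContinuousOnInterval (deriv f) a b
  bounded : ∃ C : ℝ, ∀ᵐ x, |deriv (deriv f) x| ≤ C

/-! ### The parametric family and condition A1 -/

/-- The squared Hellinger distance `∫ (f^{1/2} - g^{1/2})² dx`. -/
def hellingerSq (f g : ℝ → ℝ) : ℝ := ∫ x, (√(f x) - √(g x)) ^ 2

/-- `t` minimizes the Hellinger distance between `h` and the family `(f_t)_{t ∈ Θ}`. -/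
def IsHellingerMinimizer {p : ℕ} (Θ : Set (EuclideanSpace ℝ (Fin p)))
    (f : EuclideanSpace ℝ (Fin p) → ℝ → ℝ) (h : ℝ → ℝ) (t : EuclideanSpace ℝ (Fin p)) : Prop :=
  t ∈ Θ ∧ ∀ t' ∈ Θ, hellingerSq (f t) h ≤ hellingerSq (f t') h

/-- `T` is a minimum Hellinger distance functional: `T h` is a minimizer for every density `h`
for which one exists. -/
def IsMinHellingerFunctional {p : ℕ} (Θ : Set (EuclideanSpace ℝ (Fin p)))
    (f : EuclideanSpace ℝ (Fin p) → ℝ → ℝ) (T : (ℝ → ℝ) → EuclideanSpace ℝ (Fin p)) : Prop :=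
  ∀ h, IsDensity h → (∃ t, IsHellingerMinimizer Θ f h t) → IsHellingerMinimizer Θ f h (T h)

/-- `t ↦ f_t^{1/2}` is twice differentiable in `L_2` on `Θ` along every direction, with gradient
`s'` and matrix of second derivatives `s''`: for every unit vector `l`,
`f_{t+al}^{1/2} = f_t^{1/2} + a lᵀ s'_t + a lᵀ u_a` and `s'_{t+al} = s'_t + a lᵀ s''_t + a lᵀ v_a`
for all small `a` with `t + a l ∈ Θ`, where the components of `u_a` and of `v_a` tend to zero in
`L_2` as `a → 0`. -/
structure HasRootDerivatives {p : ℕ} (Θ : Set (EuclideanSpace ℝ (Fin p)))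
    (f : EuclideanSpace ℝ (Fin p) → ℝ → ℝ)
    (s' : EuclideanSpace ℝ (Fin p) → Fin p → ℝ → ℝ)
    (s'' : EuclideanSpace ℝ (Fin p) → Fin p → Fin p → ℝ → ℝ) : Prop where
  memLp_first : ∀ t ∈ Θ, ∀ i, MemLp (s' t i) 2 volume
  memLp_second : ∀ t ∈ Θ, ∀ i j, MemLp (s'' t i j) 2 volume
  expansion_first : ∀ t ∈ Θ, ∀ l : EuclideanSpace ℝ (Fin p), ‖l‖ = 1 →
    ∃ u : ℝ → Fin p → ℝ → ℝ,
      (∀ a i, MemLp (u a i) 2 volume) ∧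
      (∀ i, Tendsto (fun a => eLpNorm (u a i) 2 volume) (𝓝[≠] 0) (𝓝 0)) ∧
      ∀ᶠ a in 𝓝[≠] (0 : ℝ), t + a • l ∈ Θ → ∀ᵐ x,
        √(f (t + a • l) x) = √(f t x) + a * ∑ i, l i * s' t i x + a * ∑ i, l i * u a i x
  expansion_second : ∀ t ∈ Θ, ∀ l : EuclideanSpace ℝ (Fin p), ‖l‖ = 1 →
    ∃ v : ℝ → Fin p → Fin p → ℝ → ℝ,
      (∀ a i j, MemLp (v a i j) 2 volume) ∧
      (∀ i j, Tendsto (fun a => eLpNorm (v a i j) 2 volume) (𝓝[≠] 0) (𝓝 0)) ∧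
      ∀ᶠ a in 𝓝[≠] (0 : ℝ), t + a • l ∈ Θ → ∀ j, ∀ᵐ x,
        s' (t + a • l) j x
          = s' t j x + a * ∑ i, l i * s'' t i j x + a * ∑ i, l i * v a i j x

/-- Condition A1 at the density `g`. -/
structure ConditionA1 {p : ℕ} (Θ : Set (EuclideanSpace ℝ (Fin p)))
    (f : EuclideanSpace ℝ (Fin p) → ℝ → ℝ) (T : (ℝ → ℝ) → EuclideanSpace ℝ (Fin p))
    (s' : EuclideanSpace ℝ (Fin p) → Fin p → ℝ → ℝ)
    (s'' : EuclideanSpace ℝ (Fin p) → Fin p → Fin p → ℝ → ℝ) (g : ℝ → ℝ) : Prop where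
  derivatives : HasRootDerivatives Θ f s' s''
  isMinimizer : IsHellingerMinimizer Θ f g (T g)
  unique : ∀ t, IsHellingerMinimizer Θ f g t → t = T g
  mem_interior : T g ∈ interior Θ
  nonsingular : (Matrix.of fun i j => ∫ x, s'' (T g) i j x * √(g x)).det ≠ 0
  continuous : ∀ ε > 0, ∃ δ > 0, ∀ h, IsDensity h → (∃ t, IsHellingerMinimizer Θ f h t) →
    hellingerSq h g < δ → ‖T h - T g‖ < ε

end

/-! The square root is linearized at `g`. On the compact set `K` the density `g` is continuous and
positive, so it is at least some `δ > 0`, and the error of the linearization is at most a constant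
times `(g_n^* - g)²`. Hölder with exponents 2, 4, 4 bounds its integral against `σ` by a multiple of
`‖σ‖₂ ‖g_n^* - g‖²` with the `L_4(K)` norm, which is `o(n^{-1/2})` in probability. The linear term,
scaled by `n^{1/2}`, is exactly `∫ σ / (2 g^{1/2}) dB_n`, so Slutsky's theorem transfers the
Gaussian limit. Mass of `g_n^*` outside `K` is harmless because `σ` vanishes there almost
everywhere. -/

theorem abs_sqrt_sub_sqrt_sub_le {a b δ : ℝ} (hδ : 0 < δ) (ha : δ ≤ a) (hb : 0 ≤ b) :
    |(√b - √a) - (b - a) / (2 * √a)| ≤ (2 * δ * √δ)⁻¹ * (b - a) ^ 2 := by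
  have ha0 : 0 < a := hδ.trans_le ha
  have hs : 0 < √δ := Real.sqrt_pos.2 hδ
  have hsa : √δ ≤ √a := Real.sqrt_le_sqrt ha
  have hsb : 0 ≤ √b := Real.sqrt_nonneg b
  have hpa : 0 < √a := hs.trans_le hsa
  have hba : b - a = (√b - √a) * (√b + √a) := by
    linear_combination -(Real.sq_sqrt hb) + Real.sq_sqrt ha0.le
  -- The Taylor remainder is exact, so no smoothness of the root at `b` is needed and `b = 0` is
  -- allowed.
  have h1 : (√b - √a) - (b - a) / (2 * √a) = -((√b - √a) ^ 2 / (2 * √a)) := by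
    rw [hba]; field_simp; ring
  have h2 : δ * (√b - √a) ^ 2 ≤ (b - a) ^ 2 := by
    have : δ ≤ (√b + √a) ^ 2 := by
      calc δ ≤ a := ha
        _ = √a ^ 2 := (Real.sq_sqrt ha0.le).symm
        _ ≤ (√b + √a) ^ 2 := by gcongr; linarith
    rw [hba, mul_pow, mul_comm]
    gcongr
  rw [h1, abs_neg, abs_of_nonneg (by positivity)]
  calc (√b - √a) ^ 2 / (2 * √a) ≤ (√b - √a) ^ 2 / (2 * √δ) := by gcongr
    _ = (2 * δ * √δ)⁻¹ * (δ * (√b - √a) ^ 2) := by field_simp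
    _ ≤ _ := by gcongr

theorem holderTriple_four_four_two : ENNReal.HolderTriple 4 4 2 where
  inv_add_inv_eq_inv := by
    rw [← ENNReal.toReal_eq_toReal_iff' (by simp) (by simp),
      ENNReal.toReal_add (by simp) (by simp)]
    norm_num

/-- The second order remainder in the linearization of `b ↦ ∫ σ √b` at `a`. -/
theorem abs_integral_mul_sqrt_sub_sub_le {α : Type*} [MeasurableSpace α] {μ : Measure α}
    [IsFiniteMeasure μ] {σ a b : α → ℝ} {δ : ℝ} (hδ : 0 < δ) (hσ : MemLp σ 2 μ)
    (ha : Measurable a) (hb : Measurable b) (hai : Integrable a μ)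
    (hδa : ∀ᵐ x ∂μ, δ ≤ a x) (hb0 : ∀ x, 0 ≤ b x) (hD : MemLp (fun x => b x - a x) 4 μ) :
    |(∫ x, σ x * (√(b x) - √(a x)) ∂μ) -
        ((∫ x, b x * (σ x / (2 * √(a x))) ∂μ) - ∫ x, a x * (σ x / (2 * √(a x))) ∂μ)|
      ≤ (2 * δ * √δ)⁻¹ * (eLpNorm σ 2 μ).toReal *
        (eLpNorm (fun x => b x - a x) 4 μ).toReal ^ 2 := by
  have := holderTriple_four_four_two
  have hD2 : MemLp (fun x => b x - a x) 2 μ := hD.mono_exponent (by norm_num)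
  have hDD : MemLp ((fun x => b x - a x) * fun x => b x - a x) 2 μ := hD.mul hD
  have hσD : Integrable (fun x => σ x * (b x - a x)) μ := hσ.integrable_mul hD2
  have hsq : Integrable (fun x => |σ x| * (b x - a x) ^ 2) μ := by
    refine (hσ.integrable_mul hDD).norm.congr (.of_forall fun x => ?_)
    simp [pow_two]
  have hlin : Integrable (fun x => (2 * √(a x))⁻¹ * (σ x * (b x - a x))) μ := by
    refine hσD.bdd_mul (c := (2 * √δ)⁻¹) (by fun_prop) ?_
    filter_upwards [hδa] with x hx
    rw [Real.norm_of_nonneg (by positivity)]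
    have : 0 < √δ := Real.sqrt_pos.2 hδ
    gcongr
  have hroot : MemLp (fun x => √(a x)) 2 μ := by
    rw [memLp_two_iff_integrable_sq (by fun_prop)]
    refine hai.congr ?_
    filter_upwards [hδa] with x hx using (Real.sq_sqrt (hδ.le.trans hx)).symm
  -- The integrand is `σ √a / 2`, a product of two `L_2` functions.
  have hA : Integrable (fun x => a x * (σ x / (2 * √(a x)))) μ := by
    refine ((hσ.integrable_mul hroot).div_const 2).congr ?_
    filter_upwards [hδa] with x hx
    have h0 : 0 < a x := hδ.trans_le hx
    have : 0 < √(a x) := Real.sqrt_pos.2 h0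
    simp only [Pi.mul_apply]
    field_simp
    rw [Real.sq_sqrt h0.le]
  have hB : Integrable (fun x => b x * (σ x / (2 * √(a x)))) μ := by
    refine (hlin.add hA).congr (.of_forall fun x => ?_)
    simp only [Pi.add_apply, div_eq_mul_inv]
    ring
  have hbound : ∀ᵐ x ∂μ, ‖σ x * ((√(b x) - √(a x)) - (b x - a x) / (2 * √(a x)))‖
      ≤ (2 * δ * √δ)⁻¹ * (|σ x| * (b x - a x) ^ 2) := by
    filter_upwards [hδa] with x hx
    rw [norm_mul, Real.norm_eq_abs, Real.norm_eq_abs, mul_left_comm]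
    gcongr
    exact abs_sqrt_sub_sqrt_sub_le hδ hx (hb0 x)
  have hR : Integrable
      (fun x => σ x * ((√(b x) - √(a x)) - (b x - a x) / (2 * √(a x)))) μ := by
    refine (hsq.const_mul _).mono' (hσ.1.mul ?_) hbound
    exact Measurable.aestronglyMeasurable (by fun_prop)
  have hS : Integrable (fun x => σ x * (√(b x) - √(a x))) μ := by
    refine (hR.add hlin).congr (.of_forall fun x => ?_)
    simp only [Pi.add_apply, div_eq_mul_inv]
    ring
  have hsplit : (∫ x, σ x * (√(b x) - √(a x)) ∂μ) -
      ((∫ x, b x * (σ x / (2 * √(a x))) ∂μ) - ∫ x, a x * (σ x / (2 * √(a x))) ∂μ)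
      = ∫ x, σ x * ((√(b x) - √(a x)) - (b x - a x) / (2 * √(a x))) ∂μ := by
    have hBA : Integrable (fun x => b x * (σ x / (2 * √(a x))) - a x * (σ x / (2 * √(a x)))) μ :=
      hB.sub hA
    rw [← integral_sub hB hA, ← integral_sub hS hBA]
    refine integral_congr_ae (.of_forall fun x => ?_)
    ring
  have hholder : ∫ x, |σ x| * (b x - a x) ^ 2 ∂μ ≤
      (eLpNorm σ 2 μ).toReal * (eLpNorm (fun x => b x - a x) 4 μ).toReal ^ 2 := by
    have h1 : ∫ x, |σ x| * (b x - a x) ^ 2 ∂μ =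
        (eLpNorm (σ • ((fun x => b x - a x) • fun x => b x - a x)) 1 μ).toReal := by
      simp only [smul_eq_mul]
      rw [eLpNorm_one_eq_lintegral_enorm, ← integral_norm_eq_lintegral_enorm (hσ.1.mul hDD.1)]
      refine integral_congr_ae (.of_forall fun x => ?_)
      simp [pow_two]
    -- Hölder twice: `1 = 1/2 + 1/2` splits off `σ`, then `1/2 = 1/4 + 1/4` splits the square.
    have h2 := (eLpNorm_smul_le_mul_eLpNorm (p := 2) (q := 2) (r := 1) hDD.1 hσ.1).trans
      (mul_le_mul_right (eLpNorm_smul_le_mul_eLpNorm (p := 4) (q := 4) (r := 2) hD.1 hD.1) _)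
    rw [h1, pow_two, ← ENNReal.toReal_mul, ← ENNReal.toReal_mul]
    exact ENNReal.toReal_mono
      (ENNReal.mul_ne_top hσ.2.ne (ENNReal.mul_ne_top hD.2.ne hD.2.ne)) h2
  rw [hsplit, ← Real.norm_eq_abs]
  calc _ ≤ ∫ x, (2 * δ * √δ)⁻¹ * (|σ x| * (b x - a x) ^ 2) ∂μ :=
        norm_integral_le_of_norm_le (hsq.const_mul _) hbound
    _ = (2 * δ * √δ)⁻¹ * ∫ x, |σ x| * (b x - a x) ^ 2 ∂μ := integral_const_mul _ _
    _ ≤ _ := (mul_le_mul_of_nonneg_left hholder (by positivity)).trans_eq (mul_assoc _ _ _).symm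

theorem integral_densityMeasure {b : ℝ → ℝ} (hb : Measurable b) (hb0 : ∀ x, 0 ≤ b x)
    (ψ : ℝ → ℝ) : ∫ x, ψ x ∂(densityMeasure b) = ∫ x, b x * ψ x := by
  unfold densityMeasure
  rw [integral_withDensity_eq_integral_toReal_smul (by fun_prop) (by simp)]
  simp [ENNReal.toReal_ofReal, hb0]

/-! ### Measurability and sign of the Bayesian density estimate -/

section PosteriorMean

variable {H : Type*} [MeasurableSpace H] {d : H → ℝ → ℝ}

theorem measurable_likelihood (hd : Measurable (Function.uncurry d)) (n : ℕ) :
    Measurable fun q : (Fin n → ℝ) × H => likelihood d q.1 q.2 := by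
  unfold likelihood
  refine Finset.measurable_prod _ fun i _ => ENNReal.measurable_ofReal.comp ?_
  exact hd.comp (measurable_snd.prodMk ((measurable_pi_apply i).comp measurable_fst))

/-- Displays the estimate as a ratio of parameter integrals, whose measurability follows as in
Fubini's theorem. It also covers a normalizer equal to `0` or `∞`, where both sides are `0`. -/
theorem posteriorMean_eq (prior : Measure H) (hd : Measurable (Function.uncurry d)) {n : ℕ}
    (x : Fin n → ℝ) (y : ℝ) :
    posteriorMean prior d x y = (∫⁻ h, likelihood d x h ∂prior)⁻¹.toReal *
      ∫ h, (likelihood d x h).toReal * d h y ∂prior := by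
  unfold posteriorMean _root_.posterior
  have hL : Measurable (likelihood d x) :=
    (measurable_likelihood hd n).comp measurable_prodMk_left
  rw [integral_smul_measure, integral_withDensity_eq_integral_toReal_smul hL]
  · simp
  · exact .of_forall fun h => ENNReal.prod_lt_top (by simp)

theorem measurable_posteriorMean (prior : Measure H) [SFinite prior]
    (hd : Measurable (Function.uncurry d)) (n : ℕ) :
    Measurable fun q : (Fin n → ℝ) × ℝ => posteriorMean prior d q.1 q.2 := by
  simp_rw [posteriorMean_eq prior hd]
  have hL := measurable_likelihood hd n
  refine Measurable.mul ?_ ?_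
  · exact ((hL.lintegral_prod_right'.inv).ennreal_toReal).comp measurable_fst
  · refine (StronglyMeasurable.integral_prod_right' (ν := prior)
      (f := fun r : ((Fin n → ℝ) × ℝ) × H => (likelihood d r.1.1 r.2).toReal * d r.2 r.1.2)
      (Measurable.stronglyMeasurable ?_)).measurable
    refine Measurable.mul ?_ ?_
    · exact (hL.comp ((measurable_fst.comp measurable_fst).prodMk measurable_snd)).ennreal_toReal
    · exact hd.comp (measurable_snd.prodMk (measurable_snd.comp measurable_fst))

theorem posteriorMean_nonneg (prior : Measure H) (hdens : ∀ h, IsDensity (d h)) {n : ℕ}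
    (x : Fin n → ℝ) (y : ℝ) : 0 ≤ posteriorMean prior d x y :=
  integral_nonneg fun h => (hdens h).nonneg y

end PosteriorMean

theorem measurable_integral_mul_sqrt_sub {Ω : Type*} [MeasurableSpace Ω] {b : Ω → ℝ → ℝ}
    (hb : Measurable (Function.uncurry b)) {g σ : ℝ → ℝ} (hg : Measurable g)
    (hσ : AEStronglyMeasurable σ volume) :
    Measurable fun ω => ∫ x, σ x * (√(b ω x) - √(g x)) := by
  -- A Borel version of `σ` makes the integrand jointly measurable.
  have hcongr : (fun ω => ∫ x, σ x * (√(b ω x) - √(g x))) =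
      fun ω => ∫ x, hσ.mk σ x * (√(b ω x) - √(g x)) := by
    ext ω
    refine integral_congr_ae ?_
    filter_upwards [hσ.ae_eq_mk] with x hx
    rw [hx]
  rw [hcongr]
  refine (StronglyMeasurable.integral_prod_right' (ν := volume)
    (f := fun q : Ω × ℝ => hσ.mk σ q.2 * (√(b q.1 q.2) - √(g q.2)))
    (Measurable.stronglyMeasurable ?_)).measurable
  have h1 : Measurable fun q : Ω × ℝ => hσ.mk σ q.2 :=
    hσ.stronglyMeasurable_mk.measurable.comp measurable_snd
  have h2 : Measurable fun q : Ω × ℝ => √(b q.1 q.2) := hb.sqrt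
  have h3 : Measurable fun q : Ω × ℝ => √(g q.2) := (hg.comp measurable_snd).sqrt
  exact h1.mul (h2.sub h3)

/-! ### Transfer of the limit from `B_n` to the root densities -/

theorem abs_sqrt_mul_integral_sub_integralB_le {g σ b : ℝ → ℝ} {K : Set ℝ} {δ : ℝ} {n : ℕ}
    (hg : IsDensity g) (hK : IsCompact K) (hgK : ∀ x, x ∉ K → g x = 0) (hδ : 0 < δ)
    (hδg : ∀ x ∈ K, δ ≤ g x) (hσ : IsDirection g σ) (hb : Measurable b) (hb0 : ∀ x, 0 ≤ b x)
    (hD : MemLp (fun x => b x - g x) 4 (volume.restrict K)) :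
    |√(n : ℝ) * (∫ x, σ x * (√(b x) - √(g x))) -
        integralB n b g (fun x => σ x / (2 * √(g x)))|
      ≤ √(n : ℝ) * ((2 * δ * √δ)⁻¹ * (eLpNorm σ 2 (volume.restrict K)).toReal *
        (eLpNorm (fun x => b x - g x) 4 (volume.restrict K)).toReal ^ 2) := by
  have : IsFiniteMeasure (volume.restrict K) := ⟨by simpa using hK.measure_lt_top⟩
  have hmain := abs_integral_mul_sqrt_sub_sub_le hδ (hσ.memLp.restrict K) hg.measurable hb
    hg.integrable.restrict ((ae_restrict_iff' hK.measurableSet).2 (.of_forall hδg)) hb0 hD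
  -- Integrals over `K` become integrals over the line: off `K`, `σ` vanishes almost everywhere,
  -- while `σ / (2 √g)` is identically `0` by the convention for division by zero.
  rw [setIntegral_eq_integral_of_ae_compl_eq_zero (by
      filter_upwards [hσ.support] with x hx hxK
      rw [hx (hgK x hxK), zero_mul]),
    setIntegral_eq_integral_of_forall_compl_eq_zero (by
      intro x hx; simp [hgK x hx]),
    setIntegral_eq_integral_of_forall_compl_eq_zero (by
      intro x hx; simp [hgK x hx])] at hmain
  unfold integralB
  rw [integral_densityMeasure hb hb0, integral_densityMeasure hg.measurable hg.nonneg,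
    ← mul_sub, abs_mul, abs_of_nonneg (Real.sqrt_nonneg _)]
  gcongr

theorem tendsto_sqrt_mul_sq_of_tendsto_rpow {ε : ℕ → ℝ}
    (hε : Tendsto (fun n : ℕ => (n : ℝ) ^ (1 / 4 : ℝ) * ε n) atTop (𝓝 0)) :
    Tendsto (fun n : ℕ => √(n : ℝ) * ε n ^ 2) atTop (𝓝 0) := by
  have h := hε.pow 2
  rw [zero_pow two_ne_zero] at h
  refine h.congr fun n => ?_
  rw [mul_pow, Real.sqrt_eq_rpow, ← Real.rpow_natCast, ← Real.rpow_mul n.cast_nonneg]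
  norm_num

theorem measurable_sample {Ω : Type*} [MeasurableSpace Ω] {X : ℕ → Ω → ℝ}
    (hX : ∀ i, Measurable (X i)) (n : ℕ) : Measurable (sample X n) :=
  measurable_pi_lambda _ fun i => hX i

theorem measurable_uncurry_posteriorMean_sample {Ω H : Type*} [MeasurableSpace Ω]
    [MeasurableSpace H] (prior : Measure H) [SFinite prior] {d : H → ℝ → ℝ}
    (hd : Measurable (Function.uncurry d)) {X : ℕ → Ω → ℝ} (hX : ∀ i, Measurable (X i)) (n : ℕ) :
    Measurable (Function.uncurry fun ω => posteriorMean prior d (sample X n ω)) := by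
  have hS : Measurable fun q : Ω × ℝ => (sample X n q.1, q.2) :=
    ((measurable_sample hX n).comp measurable_fst).prodMk measurable_snd
  have h := (measurable_posteriorMean prior hd n).comp hS
  simp only [Function.comp_def] at h
  simpa only [Function.uncurry_def] using h

/-- If density estimates `gs` concentrate on `K` at rate `o(n^{-1/4})`, then a Gaussian limit for
`B_n` carries over to the square roots of the estimates. -/
theorem GaussianLimitB.conditionA2 {Ω : Type*} [MeasurableSpace Ω] {P : Measure Ω}
    [IsProbabilityMeasure P] {gs : ℕ → Ω → ℝ → ℝ} {g : ℝ → ℝ} (hB : GaussianLimitB P gs g)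
    (hgs : ∀ n, Measurable (Function.uncurry (gs n))) (hgs0 : ∀ n ω x, 0 ≤ gs n ω x)
    (hg : IsDensity g) {K : Set ℝ} (hK : IsCompact K) (hgK : ∀ x, x ∉ K → g x = 0)
    {δ : ℝ} (hδ : 0 < δ) (hδg : ∀ x ∈ K, δ ≤ g x) {ε : ℕ → ℝ}
    (hε : Tendsto (fun n : ℕ => (n : ℝ) ^ (1 / 4 : ℝ) * ε n) atTop (𝓝 0))
    (hconc : HasConcentrationRate P gs g K ε) : ConditionA2 P gs g := by
  intro σ hσ
  have hgs_right : ∀ n ω, Measurable (gs n ω) := fun n ω => (hgs n).of_uncurry_left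
  -- Slutsky: it remains that the difference of the two statistics tends to `0` in probability.
  refine tendstoInDistribution_of_tendstoInMeasure_sub _ _ (hB σ hσ) ?_ fun n =>
    ((measurable_integral_mul_sqrt_sub (hgs n) hg.measurable hσ.memLp.1).const_mul _).aemeasurable
  rw [tendstoInMeasure_iff_norm]
  intro η hη
  have hlim : Tendsto (fun n : ℕ => (2 * δ * √δ)⁻¹ *
      (eLpNorm σ 2 (volume.restrict K)).toReal * (√(n : ℝ) * ε n ^ 2)) atTop (𝓝 0) := by
    simpa using (tendsto_sqrt_mul_sq_of_tendsto_rpow hε).const_mul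
      ((2 * δ * √δ)⁻¹ * (eLpNorm σ 2 (volume.restrict K)).toReal)
  refine tendsto_of_tendsto_of_tendsto_of_le_of_le' tendsto_const_nhds hconc
    (.of_forall fun n => zero_le) ?_
  -- Once the deterministic bound is below `η`, a deviation of size `η` forces the concentration
  -- rate to fail.
  filter_upwards [hlim.eventually_lt_const hη] with n hn
  refine measure_mono fun ω hω => ?_
  simp only [Set.mem_ofPred_eq, Pi.zero_apply, sub_zero, Pi.sub_apply, Real.norm_eq_abs] at hω ⊢
  by_contra! hle
  have hD : MemLp (fun x => gs n ω x - g x) 4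
      (volume.restrict K) :=
    ⟨((hgs_right n ω).sub hg.measurable).aestronglyMeasurable,
      hle.trans_lt ENNReal.ofReal_lt_top⟩
  refine absurd (hω.trans (abs_sqrt_mul_integral_sub_integralB_le hg hK hgK hδ hδg hσ
    (hgs_right n ω) (hgs0 n ω) hD)) (not_le.2 (lt_of_le_of_lt ?_ hn))
  have hsq : (eLpNorm (fun x => gs n ω x - g x) 4
      (volume.restrict K)).toReal ^ 2 ≤ ε n ^ 2 := by
    rcases le_total 0 (ε n) with h0 | h0
    · have := ENNReal.toReal_mono ENNReal.ofReal_ne_top hle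
      rw [ENNReal.toReal_ofReal h0] at this
      gcongr
    -- A nonpositive `ε n` is truncated to `0`, so the `L_4` norm itself is `0`.
    · rw [ENNReal.ofReal_of_nonpos h0, nonpos_iff_eq_zero] at hle
      rw [hle]
      simpa using sq_nonneg (ε n)
  rw [mul_left_comm]
  gcongr

theorem lemma1
    -- the i.i.d. observations, with density `g`
    {Ω : Type*} [MeasurableSpace Ω] (P : Measure Ω) [IsProbabilityMeasure P]
    (g : ℝ → ℝ) (hg : IsDensity g)
    (X : ℕ → Ω → ℝ) (hX : ∀ i, Measurable (X i)) (hindep : iIndepFun X P)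
    (hlaw : ∀ i, P.map (X i) = densityMeasure g)
    -- the prior on densities
    {H : Type*} [MeasurableSpace H] (prior : Measure H) [IsProbabilityMeasure prior]
    (d : H → ℝ → ℝ) (hd : Measurable (Function.uncurry d)) (hdens : ∀ h, IsDensity (d h))
    -- the parametric family and condition A1
    {p : ℕ} (Θ : Set (EuclideanSpace ℝ (Fin p)))
    (f : EuclideanSpace ℝ (Fin p) → ℝ → ℝ) (hf : ∀ t ∈ Θ, IsDensity (f t))
    (T : (ℝ → ℝ) → EuclideanSpace ℝ (Fin p)) (hT : IsMinHellingerFunctional Θ f T)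
    (s' : EuclideanSpace ℝ (Fin p) → Fin p → ℝ → ℝ)
    (s'' : EuclideanSpace ℝ (Fin p) → Fin p → Fin p → ℝ → ℝ)
    (hA1 : ConditionA1 Θ f T s' s'' g)
    -- b1, b2: the kernel
    (k : ℝ → ℝ) (hk : IsDensity k) (hk_symm : ∀ x, k (-x) = k x)
    (hk_supp : HasCompactSupport k) (hk_ac : TwiceACBounded k)
    -- b3: the density `g` on its compact support
    (K : Set ℝ) (hK : IsCompact K) (hgK : ∀ x, x ∉ K → g x = 0) (hg_pos : ∀ x ∈ K, 0 < g x)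
    (hg_ac : ∃ γ : ℝ → ℝ, TwiceACBounded γ ∧ Set.EqOn g γ K)
    -- b4: the bandwidth
    (c : ℕ → ℝ) (hc : Tendsto (fun n : ℕ => √(n : ℝ) * c n) atTop atTop)
    (hc_sq : Tendsto (fun n : ℕ => √(n : ℝ) * c n ^ 2) atTop (𝓝 0))
    -- b5: the scale estimator
    (s : (n : ℕ) → (Fin n → ℝ) → ℝ)
    (hs : ∃ s₀ : ℝ, 0 < s₀ ∧
      BoundedInProbability P (fun n ω => √(n : ℝ) * (s n (sample X n ω) - s₀)))
    -- the Gaussian limit of `B_n` and the concentration rate of the Bayesian density estimate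
    (hB : GaussianLimitB P (fun n ω => posteriorMean prior d (sample X n ω)) g)
    (hrate : ∃ ε : ℕ → ℝ, Tendsto (fun n : ℕ => (n : ℝ) ^ (1 / 4 : ℝ) * ε n) atTop (𝓝 0) ∧
      HasConcentrationRate P (fun n ω => posteriorMean prior d (sample X n ω)) g K ε) :
    ConditionA2 P (fun n ω => posteriorMean prior d (sample X n ω)) g := by
  obtain ⟨ε, hε, hconc⟩ := hrate
  obtain ⟨γ, hγ, hgγ⟩ := hg_ac
  -- On the compact set `K`, `g` equals the continuous `γ`, so positivity there is uniform.
  obtain ⟨δ, hδ, hδg⟩ := hK.exists_forall_le'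
    (hγ.differentiable.continuous.continuousOn.congr hgγ) hg_pos
  refine hB.conditionA2 (measurable_uncurry_posteriorMean_sample prior hd hX)
    (fun n ω => posteriorMean_nonneg prior hdens _)
    hg hK hgK hδ hδg hε hconc
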